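/- Let $L\ge 1$ and $\mathcal H_L=(\mathbb C^3)^{\otimes L}$, and let $h_0=\mathbb C^3$ be an auxiliary space. On $\mathbb C^3\otimes\mathbb C^3$ let $P$ be the permutation operator, $P(v\otimes w)=w\otimes v$, and let $K$ be the operator with matrix elements $\langle a,b|K|c,d\rangle=\delta_{ab}\delta_{cd}$. For $u\in\mathbb C$ put $$R^{3}(u)=\frac{u+\mathrm i P}{u+\mathrm i},\qquad R^{\bar 3}(u)=\frac{u+\frac{3\mathrm i}{2}-\mathrm i K}{u+\frac{3\mathrm i}{2}} .$$ For $\Lambda\in\{3,\bar 3\}$ let $R^\Lambda_{j0}(u)$ be the operator on $\mathcal H_L\otimes h_0$ that acts as $R^\Lambda(u)$ on the $j$-th tensor factor of $\mathcal H_L$ and on $h_0$, and as the identity on the other factors. Define the transfer matrix and its space-reflected version, which are operators on $\mathcal H_L$, by $$t^\Lambda(u)=\operatorname{Tr}_0 R^\Lambda_{10}(u)R^\Lambda_{20}(u)\cdots R^\Lambda_{L0}(u),\qquad \bar t^{\,\Lambda}(u)=\operatorname{Tr}_0 R^\Lambda_{L0}(u)\cdots R^\Lambda_{20}(u)R^\Lambda_{10}(u).$$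 Let $\|A\|_{\mathrm{HS}}=\bigl(3^{-L}\operatorname{Tr}(A^\dagger A)\bigr)^{1/2}$ be the normalized Hilbert–Schmidt norm on $\operatorname{End}(\mathcal H_L)$. **Theorem.** Let $u\in\mathbb C$ with $|\operatorname{Im}u|<\tfrac12$. Then $$\bar t^{\,3}(-u)\,t^{3}(u)\approx 1\qquad\text{and}\qquad \bar t^{\,\bar 3}(-u)\,t^{\bar 3}(u)\approx 1,$$ where $A\approx B$ means that there is a real $\alpha>0$ (independent of $L$) such that $\|A-B\|_{\mathrm{HS}}=O(e^{-\alpha L})$ as $L\to\infty$. -/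

import Mathlib

namespace LaiSutherland

/-- Linear operators on the tensor product of two copies of `ℂ³`, as matrices in the product
basis; in the transfer matrices the first factor is a physical site and the second one is the
auxiliary space. -/
abbrev LocalOp := Matrix (Fin 3 × Fin 3) (Fin 3 × Fin 3) ℂ

/-- Linear operators on the chain Hilbert space `(ℂ³)^{⊗ L}`, as matrices in the product basis,
whose elements are labelled by the configurations `Fin L → Fin 3`. -/
abbrev ChainOp (L : ℕ) := Matrix (Fin L → Fin 3) (Fin L → Fin 3) ℂ

/-- Linear operators on `(ℂ³)^{⊗ L} ⊗ ℂ³`, the chain tensored with the auxiliary space. -/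
abbrev ExtOp (L : ℕ) := Matrix ((Fin L → Fin 3) × Fin 3) ((Fin L → Fin 3) × Fin 3) ℂ

/-- The permutation operator `P (v ⊗ w) = w ⊗ v`. -/
def permOp : LocalOp :=
  Matrix.of fun x y => if x.1 = y.2 ∧ x.2 = y.1 then 1 else 0

/-- The trace (Temperley-Lieb) operator `K`, the partial transpose of `P`, with matrix elements
`⟨a b| K |c d⟩ = δ_{a b} δ_{c d}`. -/
def traceOp : LocalOp :=
  Matrix.of fun x y => if x.1 = x.2 ∧ y.1 = y.2 then 1 else 0

/-- The fundamental `R`-matrix `R(u) = (u + i P) / (u + i)`. -/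
noncomputable def R3 (u : ℂ) : LocalOp :=
  (u + Complex.I)⁻¹ • (u • (1 : LocalOp) + Complex.I • permOp)

/-- The `R`-matrix `(u + 3i/2 - i K) / (u + 3i/2)` on the product of the defining and the
conjugate representation. -/
noncomputable def R3bar (u : ℂ) : LocalOp :=
  (u + 3 * Complex.I / 2)⁻¹ •
    ((u + 3 * Complex.I / 2) • (1 : LocalOp) - Complex.I • traceOp)

/-- The operator `A_{j0}`: `A` acting on the site `j` of the chain and on the auxiliary space `0`,
and as the identity on all other sites. -/
def onSite {L : ℕ} (A : LocalOp) (j : Fin L) : ExtOp L :=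
  Matrix.of fun x y =>
    if ∀ k, k ≠ j → x.1 k = y.1 k then A (x.1 j, x.2) (y.1 j, y.2) else 0

/-- The partial trace `Tr_0` over the auxiliary space. -/
def traceAux {L : ℕ} (M : ExtOp L) : ChainOp L :=
  Matrix.of fun s s' => ∑ a, M (s, a) (s', a)

/-- `Tr_0 A_{10} A_{20} ⋯ A_{L0}`. -/
def transfer (A : LocalOp) (L : ℕ) : ChainOp L :=
  traceAux (List.ofFn fun j : Fin L => onSite A j).prod

/-- The space reflected version `Tr_0 A_{L0} ⋯ A_{20} A_{10}`. -/
def transferRefl (A : LocalOp) (L : ℕ) : ChainOp L :=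
  traceAux (List.ofFn fun j : Fin L => onSite A j).reverse.prod

/-- The fundamental transfer matrix `t³(u)`. -/
noncomputable def t3 (L : ℕ) (u : ℂ) : ChainOp L := transfer (R3 u) L

/-- The transfer matrix `t^{3̄}(u)` of the conjugate representation. -/
noncomputable def t3bar (L : ℕ) (u : ℂ) : ChainOp L := transfer (R3bar u) L

/-- The space reflection of `t³(u)`. -/
noncomputable def t3Refl (L : ℕ) (u : ℂ) : ChainOp L := transferRefl (R3 u) L

/-- The space reflection of `t^{3̄}(u)`. -/
noncomputable def t3barRefl (L : ℕ) (u : ℂ) : ChainOp L := transferRefl (R3bar u) L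

/-- The normalized Hilbert-Schmidt norm `(3^{-L} Tr (A† A))^{1/2}`, for which `‖1‖ = 1`. -/
noncomputable def hsNorm {L : ℕ} (A : ChainOp L) : ℝ :=
  Real.sqrt (((3 : ℝ) ^ L)⁻¹ * (Matrix.trace (A.conjTranspose * A)).re)

/-- `A ≈ B`: `‖A - B‖ = O(e^{-α L})` in the Hilbert-Schmidt norm, for some `α > 0`. -/
def AsympEq (A B : (L : ℕ) → ChainOp L) : Prop :=
  ∃ α : ℝ, 0 < α ∧
    (fun L : ℕ => hsNorm (A L - B L)) =O[Filter.atTop] fun L : ℕ => Real.exp (-α * (L : ℝ))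

/-- The physical strip `|Im u| < 1/2`. -/
def physicalStrip : Set ℂ := {u | |u.im| < 1 / 2}

end LaiSutherland

/-!
The product of the reflected transfer matrix of `B` with the transfer matrix of `A` is built from
two auxiliary spaces, that is, from the nine-dimensional space of auxiliary operators `X`. A site in
the states `s`, `s'` acts there by the superoperator `X ↦ ∑ r, A^{r s'} X B^{s r}` (`siteMap`), where
`A^{r s}` are the `3 × 3` blocks of `A`, and the matrix elements of the product are the traces of
the composed superoperators (`transferRefl_mul_transfer_apply`).

If `B * A = 1`, which for `B = R(-u)`, `A = R(u)` is the unitarity of the `R`-matrix, the site maps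
satisfy `tr (siteMap s s' X) = δ_{s s'} tr X`. They preserve the traceless operators, and the
one-dimensional quotient contributes exactly the identity, so that the deviation from the identity
is the part of the trace coming from the traceless operators
(`transferRefl_mul_transfer_sub_one_apply`). Its Hilbert-Schmidt norm is governed by the mean square
of the site maps: if `∑ s s', ‖siteMap s s' X‖² ≤ κ ‖X‖²` for traceless `X`, its square is
`O((κ / 3)^L)` (`asympEq_one_of_contraction`).

The traceless operators form an irreducible representation of `SU(3)`, so this mean square is a
scalar multiple of `‖X‖²`; it is found by direct computation (`sum_normSq_add_commutator` and
`sum_normSq_one_sub_smul_traceOp`). For both `R`-matrices `κ / 3 < 1` is equivalent to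
`4 (Im u)² < 1`, which is the physical strip.
-/

namespace LaiSutherland

/-! ### Matrix elements of the transfer matrices -/

/-- The block of `A` between the physical basis states `r` and `s`, an operator on the auxiliary
space. -/
def auxBlock (A : LocalOp) (r s : Fin 3) : Matrix (Fin 3) (Fin 3) ℂ :=
  Matrix.of fun a b => A (r, a) (s, b)

/-- In a product over distinct sites each factor changes the configuration at its own site only,
so no intermediate configuration remains to be summed over. -/
lemma list_prod_onSite_apply {L : ℕ} (A : LocalOp) (l : List (Fin L)) (hl : l.Nodup)
    (s s' : Fin L → Fin 3) (a b : Fin 3) :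
    (l.map (onSite A)).prod (s, a) (s', b) =
      if ∀ k, k ∉ l → s k = s' k then
        (l.map fun j => auxBlock A (s j) (s' j)).prod a b else 0 := by
  induction l generalizing s a with
  | nil =>
    by_cases h : s = s'
    · subst h
      simp [Matrix.one_apply]
    · have h' : ¬ ∀ k, s k = s' k := fun H => h (funext H)
      simp [h, h']
  | cons j l ih =>
    obtain ⟨hj, hl⟩ := List.nodup_cons.1 hl
    simp only [List.map_cons, List.prod_cons, Matrix.mul_apply, Fintype.sum_prod_type]
    -- The first factor fixes the sites other than `j` and the remaining ones fix the site `j`.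
    rw [Finset.sum_eq_single (Function.update s j (s' j))]
    · have hsite : ∀ c, onSite A j (s, a) (Function.update s j (s' j), c) =
          auxBlock A (s j) (s' j) a c := fun c => by
        simp +contextual [onSite, auxBlock]
      have hmap : (l.map fun i => auxBlock A (Function.update s j (s' j) i) (s' i)) =
          l.map fun i => auxBlock A (s i) (s' i) := by
        refine List.map_congr_left fun i hi => ?_
        rw [Function.update_of_ne (by rintro rfl; exact hj hi)]
      have hiff : (∀ k, k ∉ l → Function.update s j (s' j) k = s' k) ↔
          ∀ k, k ∉ j :: l → s k = s' k := by
        refine forall_congr' fun k => ?_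
        rcases eq_or_ne k j with rfl | hk
        · simp
        · simp [hk]
      simp only [hsite, ih hl, hmap, hiff, mul_ite, mul_zero]
      split_ifs <;> simp
    · intro r _ hr
      refine Finset.sum_eq_zero fun c _ => ?_
      rw [ih hl]
      by_cases h1 : ∀ k, k ≠ j → s k = r k
      · by_cases h2 : ∀ k, k ∉ l → r k = s' k
        · refine absurd (funext fun k => ?_) hr
          rcases eq_or_ne k j with rfl | hk
          · simp [h2 k hj]
          · simp [hk, h1 k hk]
        · rw [if_neg h2, mul_zero]
      · have hsite : onSite A j (s, a) (r, c) = 0 := if_neg h1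
        rw [hsite, zero_mul]
    · simp

lemma transfer_apply (A : LocalOp) {L : ℕ} (s s' : Fin L → Fin 3) :
    transfer A L s s' = (List.ofFn fun j => auxBlock A (s j) (s' j)).prod.trace := by
  simp only [transfer, traceAux, Matrix.of_apply, Matrix.trace, Matrix.diag_apply]
  refine Finset.sum_congr rfl fun a _ => ?_
  rw [List.ofFn_eq_map, list_prod_onSite_apply A _ (List.nodup_finRange L), if_pos (by simp),
    List.ofFn_eq_map]

lemma transferRefl_apply (A : LocalOp) {L : ℕ} (s s' : Fin L → Fin 3) :
    transferRefl A L s s' =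
      (List.ofFn fun j => auxBlock A (s j) (s' j)).reverse.prod.trace := by
  simp only [transferRefl, traceAux, Matrix.of_apply, Matrix.trace, Matrix.diag_apply]
  refine Finset.sum_congr rfl fun a _ => ?_
  rw [List.ofFn_eq_map, ← List.map_reverse,
    list_prod_onSite_apply A _ (List.nodup_reverse.2 (List.nodup_finRange L)),
    if_pos (by simp), List.ofFn_eq_map, List.map_reverse]

/-! ### Superoperators on the auxiliary space -/

/-- The superoperator `X ↦ ∑ r, A^{r s'} X B^{s r}` on auxiliary operators, by which one site
enters the product of the reflected transfer matrix of `B` with the transfer matrix of `A`. -/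
def siteMap (B A : LocalOp) (s s' : Fin 3) :
    Matrix (Fin 3) (Fin 3) ℂ →ₗ[ℂ] Matrix (Fin 3) (Fin 3) ℂ :=
  ∑ r, (LinearMap.mulLeft ℂ (auxBlock A r s')).comp (LinearMap.mulRight ℂ (auxBlock B s r))

lemma siteMap_apply (B A : LocalOp) (s s' : Fin 3) (X : Matrix (Fin 3) (Fin 3) ℂ) :
    siteMap B A s s' X = ∑ r, auxBlock A r s' * X * auxBlock B s r := by
  simp [siteMap, LinearMap.sum_apply, mul_assoc]

/-- The composition of the superoperators `siteMap` along the chain, the first site outermost. -/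
def chainMap (B A : LocalOp) : {L : ℕ} → (s s' : Fin L → Fin 3) →
    Matrix (Fin 3) (Fin 3) ℂ →ₗ[ℂ] Matrix (Fin 3) (Fin 3) ℂ
  | 0, _, _ => LinearMap.id
  | _ + 1, s, s' => (siteMap B A (s 0) (s' 0)).comp (chainMap B A (Fin.tail s) (Fin.tail s'))

lemma sum_config_succ {L : ℕ} {M : Type*} [AddCommMonoid M] (f : (Fin (L + 1) → Fin 3) → M) :
    ∑ s, f s = ∑ c : Fin 3, ∑ s : Fin L → Fin 3, f (Fin.cons c s) := by
  rw [← Fintype.sum_prod_type']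
  exact (Fintype.sum_equiv (Fin.consEquiv fun _ => Fin 3) _ _ fun _ => rfl).symm

/-- Summing over the intermediate configuration factorizes site by site, since the reversed order
of the factors of `B` puts the blocks of each site next to each other. -/
lemma chainMap_apply (B A : LocalOp) {L : ℕ} (s s' : Fin L → Fin 3)
    (X : Matrix (Fin 3) (Fin 3) ℂ) :
    chainMap B A s s' X = ∑ r : Fin L → Fin 3,
      (List.ofFn fun j => auxBlock A (r j) (s' j)).prod * X *
        (List.ofFn fun j => auxBlock B (s j) (r j)).reverse.prod := by
  induction L with
  | zero => simp [chainMap]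
  | succ L ih =>
    simp only [chainMap, LinearMap.comp_apply, ih, siteMap_apply, sum_config_succ,
      List.ofFn_succ, List.prod_cons, List.reverse_cons, List.prod_append, List.prod_nil,
      mul_one, Fin.cons_zero, Fin.cons_succ, Finset.mul_sum, Finset.sum_mul, Fin.tail, mul_assoc]

lemma transferRefl_mul_transfer_apply (B A : LocalOp) {L : ℕ} (s s' : Fin L → Fin 3) :
    (transferRefl B L * transfer A L) s s' =
      ∑ a, ∑ b, chainMap B A s s' (Matrix.single a b 1) a b := by
  simp only [Matrix.mul_apply, transfer_apply, transferRefl_apply, chainMap_apply,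
    Matrix.sum_apply, Matrix.trace, Matrix.diag_apply]
  rw [Finset.sum_congr rfl fun a _ => Finset.sum_comm, Finset.sum_comm]
  refine Finset.sum_congr rfl fun r _ => ?_
  rw [mul_comm, Finset.sum_mul_sum]
  refine Finset.sum_congr rfl fun a _ => Finset.sum_congr rfl fun b _ => ?_
  simp [Matrix.single_apply, ite_and]

/-! ### Unitarity and the traceless part -/

lemma sum_auxBlock_mul {B A : LocalOp} (h : B * A = 1) (s s' : Fin 3) :
    ∑ r, auxBlock B s r * auxBlock A r s' = if s = s' then 1 else 0 := by
  ext a b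
  have := congrFun (congrFun h (s, a)) (s', b)
  simp only [Matrix.mul_apply, Fintype.sum_prod_type, Matrix.one_apply, Prod.mk.injEq] at this
  simp only [Matrix.sum_apply, Matrix.mul_apply, auxBlock, Matrix.of_apply, this]
  split_ifs <;> simp_all [Matrix.one_apply]

lemma trace_siteMap {B A : LocalOp} (h : B * A = 1) (s s' : Fin 3)
    (X : Matrix (Fin 3) (Fin 3) ℂ) :
    (siteMap B A s s' X).trace = if s = s' then X.trace else 0 := by
  have : (siteMap B A s s' X).trace =
      ((∑ r, auxBlock B s r * auxBlock A r s') * X).trace := by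
    rw [siteMap_apply, Finset.sum_mul, Matrix.trace_sum, Matrix.trace_sum]
    refine Finset.sum_congr rfl fun r _ => ?_
    rw [Matrix.trace_mul_comm, ← Matrix.mul_assoc]
  rw [this, sum_auxBlock_mul h]
  split_ifs <;> simp

lemma trace_chainMap {B A : LocalOp} (h : B * A = 1) {L : ℕ} (s s' : Fin L → Fin 3)
    (X : Matrix (Fin 3) (Fin 3) ℂ) :
    (chainMap B A s s' X).trace = if s = s' then X.trace else 0 := by
  induction L with
  | zero => simp [chainMap, Subsingleton.elim s s']
  | succ L ih =>
    have : s = s' ↔ s 0 = s' 0 ∧ Fin.tail s = Fin.tail s' := by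
      conv_lhs => rw [← Fin.cons_self_tail s, ← Fin.cons_self_tail s', Fin.cons_inj]
    simp only [chainMap, LinearMap.comp_apply, trace_siteMap h, ih, this, ite_and]

/-- The traceless part `e_{ab} - δ_{ab} / 3` of a matrix unit. -/
noncomputable def tracelessUnit (a b : Fin 3) : Matrix (Fin 3) (Fin 3) ℂ :=
  Matrix.single a b 1 - (if a = b then (3 : ℂ)⁻¹ else 0) • 1

lemma trace_tracelessUnit (a b : Fin 3) : (tracelessUnit a b).trace = 0 := by
  rcases eq_or_ne a b with rfl | h
  · simp [tracelessUnit]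
  · simp [tracelessUnit, h]

/-- The trace part of the auxiliary space contributes the identity, so that only traceless
auxiliary operators remain in the deviation from it. -/
lemma transferRefl_mul_transfer_sub_one_apply {B A : LocalOp} (h : B * A = 1) {L : ℕ}
    (s s' : Fin L → Fin 3) :
    (transferRefl B L * transfer A L - 1) s s' =
      ∑ a, ∑ b, chainMap B A s s' (tracelessUnit a b) a b := by
  have h1 : (3 : ℂ)⁻¹ * ∑ a, chainMap B A s s' 1 a a = (1 : ChainOp L) s s' := by
    have := trace_chainMap h s s' 1
    simp only [Matrix.trace, Matrix.diag_apply] at this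
    rw [this, Matrix.one_apply]
    split_ifs <;> simp
  rw [Matrix.sub_apply, transferRefl_mul_transfer_apply, ← h1]
  have h2 : ∀ a b, chainMap B A s s' (tracelessUnit a b) a b =
      chainMap B A s s' (Matrix.single a b 1) a b -
        if a = b then 3⁻¹ * chainMap B A s s' 1 a b else 0 := fun a b => by
    rw [tracelessUnit, map_sub, map_smul, Matrix.sub_apply, Matrix.smul_apply, smul_eq_mul,
      ite_mul, zero_mul]
  simp [h2, Finset.mul_sum]

/-! ### Contraction in the Hilbert-Schmidt norm -/

/-- The squared Hilbert-Schmidt norm of an operator on the auxiliary space. -/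
noncomputable def hsSq (X : Matrix (Fin 3) (Fin 3) ℂ) : ℝ :=
  ∑ a, ∑ b, Complex.normSq (X a b)

lemma hsSq_nonneg (X : Matrix (Fin 3) (Fin 3) ℂ) : 0 ≤ hsSq X :=
  Finset.sum_nonneg fun _ _ => Finset.sum_nonneg fun _ _ => Complex.normSq_nonneg _

lemma normSq_le_hsSq (X : Matrix (Fin 3) (Fin 3) ℂ) (a b : Fin 3) :
    Complex.normSq (X a b) ≤ hsSq X :=
  (Finset.single_le_sum (f := fun b => Complex.normSq (X a b))
    (fun _ _ => Complex.normSq_nonneg _) (Finset.mem_univ b)).trans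
  (Finset.single_le_sum (f := fun a => ∑ b, Complex.normSq (X a b))
    (fun _ _ => Finset.sum_nonneg fun _ _ => Complex.normSq_nonneg _) (Finset.mem_univ a))

lemma sum_hsSq_chainMap_le {B A : LocalOp} (h : B * A = 1) {κ : ℝ} (hκ : 0 ≤ κ)
    (hc : ∀ X : Matrix (Fin 3) (Fin 3) ℂ, X.trace = 0 →
      ∑ s, ∑ s', hsSq (siteMap B A s s' X) ≤ κ * hsSq X)
    {X : Matrix (Fin 3) (Fin 3) ℂ} (hX : X.trace = 0) (L : ℕ) :
    ∑ s : Fin L → Fin 3, ∑ s', hsSq (chainMap B A s s' X) ≤ κ ^ L * hsSq X := by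
  induction L with
  | zero => simp [chainMap]
  | succ L ih =>
    calc ∑ s : Fin (L + 1) → Fin 3, ∑ s', hsSq (chainMap B A s s' X)
        = ∑ s : Fin L → Fin 3, ∑ s' : Fin L → Fin 3, ∑ c, ∑ c',
            hsSq (siteMap B A c c' (chainMap B A s s' X)) := by
          simp only [sum_config_succ, chainMap, LinearMap.comp_apply, Fin.cons_zero,
            Fin.tail_cons]
          rw [Finset.sum_comm]
          refine Finset.sum_congr rfl fun s _ => ?_
          rw [Finset.sum_congr rfl fun c _ => Finset.sum_comm, Finset.sum_comm]
      _ ≤ ∑ s : Fin L → Fin 3, ∑ s' : Fin L → Fin 3, κ * hsSq (chainMap B A s s' X) := by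
          refine Finset.sum_le_sum fun s _ => Finset.sum_le_sum fun s' _ => hc _ ?_
          simp [trace_chainMap h, hX]
      _ ≤ κ ^ (L + 1) * hsSq X := by
          simp only [← Finset.mul_sum]
          rw [pow_succ', mul_assoc]
          exact mul_le_mul_of_nonneg_left ih hκ

lemma re_trace_conjTranspose_mul_self {L : ℕ} (D : ChainOp L) :
    (Matrix.trace (D.conjTranspose * D)).re = ∑ s, ∑ s', Complex.normSq (D s s') := by
  rw [Finset.sum_comm]
  simp only [Matrix.trace, Matrix.diag_apply, Matrix.mul_apply, Matrix.conjTranspose_apply,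
    Complex.re_sum]
  refine Finset.sum_congr rfl fun s _ => Finset.sum_congr rfl fun s' _ => ?_
  simp [Complex.normSq_apply]

lemma normSq_sum_sum_le (f : Fin 3 → Fin 3 → ℂ) :
    Complex.normSq (∑ a, ∑ b, f a b) ≤ 9 * ∑ a, ∑ b, Complex.normSq (f a b) := by
  simp only [Complex.normSq_eq_norm_sq, ← Fintype.sum_prod_type']
  refine (pow_le_pow_left₀ (norm_nonneg _) (norm_sum_le _ _) 2).trans
    (sq_sum_le_card_mul_sum_sq.trans_eq ?_)
  norm_num

/-- If the site maps contract traceless auxiliary operators by a factor `κ / 3 < 1` in mean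
square, the product of the two transfer matrices is exponentially close to the identity. -/
theorem asympEq_one_of_contraction {B A : LocalOp} (h : B * A = 1) {κ₀ : ℝ} (hκ₀ : κ₀ < 3)
    (hc₀ : ∀ X : Matrix (Fin 3) (Fin 3) ℂ, X.trace = 0 →
      ∑ s, ∑ s', hsSq (siteMap B A s s' X) ≤ κ₀ * hsSq X) :
    AsympEq (fun L => transferRefl B L * transfer A L) (fun _ => 1) := by
  -- The factor may vanish (it does at `u = 0`), so it is enlarged to have a logarithm.
  obtain ⟨κ, hκ, hκ3, hc⟩ : ∃ κ : ℝ, 0 < κ ∧ κ < 3 ∧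
      ∀ X : Matrix (Fin 3) (Fin 3) ℂ, X.trace = 0 →
        ∑ s, ∑ s', hsSq (siteMap B A s s' X) ≤ κ * hsSq X :=
    ⟨max κ₀ 1, by positivity, max_lt hκ₀ (by norm_num), fun X hX => (hc₀ X hX).trans
      (mul_le_mul_of_nonneg_right (le_max_left _ _) (hsSq_nonneg X))⟩
  have hpos : 0 < κ / 3 := by positivity
  have hlog : Real.log (κ / 3) < 0 := Real.log_neg hpos (by linarith)
  set C : ℝ := 9 * ∑ a, ∑ b, hsSq (tracelessUnit a b) with hC
  refine ⟨-Real.log (κ / 3) / 2, by linarith, Asymptotics.IsBigO.of_bound (Real.sqrt C) ?_⟩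
  refine Filter.Eventually.of_forall fun L => ?_
  have hexp : Real.exp (-(-Real.log (κ / 3) / 2) * (L : ℝ)) = Real.sqrt ((κ / 3) ^ L) := by
    rw [eq_comm, Real.sqrt_eq_iff_mul_self_eq (by positivity) (by positivity), ← Real.exp_add,
      ← Real.exp_log hpos, ← Real.exp_nat_mul, Real.log_exp]
    ring_nf
  have hcomm : ∑ s : Fin L → Fin 3, ∑ s' : Fin L → Fin 3,
      ∑ a, ∑ b, hsSq (chainMap B A s s' (tracelessUnit a b)) =
      ∑ a, ∑ b, ∑ s : Fin L → Fin 3, ∑ s' : Fin L → Fin 3,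
        hsSq (chainMap B A s s' (tracelessUnit a b)) := by
    have (f : (Fin L → Fin 3) → (Fin L → Fin 3) → Fin 3 → Fin 3 → ℝ) :
        ∑ s, ∑ s', ∑ a, ∑ b, f s s' a b = ∑ a, ∑ b, ∑ s, ∑ s', f s s' a b := by
      have := Finset.sum_comm (s := Finset.univ) (t := Finset.univ)
        (f := fun (p : (Fin L → Fin 3) × (Fin L → Fin 3)) (q : Fin 3 × Fin 3) =>
          f p.1 p.2 q.1 q.2)
      simpa only [Fintype.sum_prod_type] using this
    exact this _
  rw [hexp, Real.norm_of_nonneg (Real.sqrt_nonneg _), hsNorm, Real.norm_of_nonneg (Real.sqrt_nonneg _),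
    ← Real.sqrt_mul' _ (by positivity)]
  refine Real.sqrt_le_sqrt ?_
  rw [re_trace_conjTranspose_mul_self, div_pow, div_eq_inv_mul, mul_left_comm]
  refine mul_le_mul_of_nonneg_left ?_ (by positivity)
  calc ∑ s : Fin L → Fin 3, ∑ s' : Fin L → Fin 3,
        Complex.normSq ((transferRefl B L * transfer A L - 1) s s')
      ≤ ∑ s : Fin L → Fin 3, ∑ s' : Fin L → Fin 3,
        9 * ∑ a, ∑ b, hsSq (chainMap B A s s' (tracelessUnit a b)) := by
        refine Finset.sum_le_sum fun s _ => Finset.sum_le_sum fun s' _ => ?_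
        rw [transferRefl_mul_transfer_sub_one_apply h]
        refine (normSq_sum_sum_le _).trans (mul_le_mul_of_nonneg_left ?_ (by norm_num))
        exact Finset.sum_le_sum fun a _ => Finset.sum_le_sum fun b _ => normSq_le_hsSq _ a b
    _ = 9 * ∑ a, ∑ b, ∑ s : Fin L → Fin 3, ∑ s' : Fin L → Fin 3,
        hsSq (chainMap B A s s' (tracelessUnit a b)) := by
        simp only [← Finset.mul_sum, hcomm]
    _ ≤ 9 * ∑ a, ∑ b, κ ^ L * hsSq (tracelessUnit a b) := by
        refine mul_le_mul_of_nonneg_left ?_ (by norm_num)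
        exact Finset.sum_le_sum fun a _ => Finset.sum_le_sum fun b _ =>
          sum_hsSq_chainMap_le h hκ.le hc (trace_tracelessUnit a b) L
    _ = C * κ ^ L := by
        simp only [← Finset.mul_sum, hC]
        ring

/-! ### The site maps of the two `R`-matrices -/

lemma permOp_mul_permOp : permOp * permOp = 1 := by
  ext ⟨a, b⟩ ⟨c, d⟩
  fin_cases a <;> fin_cases b <;> fin_cases c <;> fin_cases d <;>
    simp [permOp, Matrix.mul_apply, Fintype.sum_prod_type, Fin.sum_univ_three]

lemma traceOp_mul_traceOp : traceOp * traceOp = (3 : ℂ) • traceOp := by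
  ext ⟨a, b⟩ ⟨c, d⟩
  simp only [traceOp, Matrix.mul_apply, Fintype.sum_prod_type, Matrix.of_apply,
    Matrix.smul_apply, Fin.sum_univ_three]
  by_cases h : a = b <;> by_cases h' : c = d <;> simp [h, h']
  norm_num

lemma R3_neg_mul_R3 {u : ℂ} (h₁ : u + Complex.I ≠ 0) (h₂ : -u + Complex.I ≠ 0) :
    R3 (-u) * R3 u = 1 := by
  have : (-u • (1 : LocalOp) + Complex.I • permOp) * (u • (1 : LocalOp) + Complex.I • permOp) =
      ((-u + Complex.I) * (u + Complex.I)) • (1 : LocalOp) := by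
    simp only [add_mul, mul_add, smul_mul_assoc, mul_smul_comm, one_mul, mul_one,
      permOp_mul_permOp]
    module
  rw [R3, R3, smul_mul_smul_comm, this, smul_smul, ← mul_inv, inv_mul_cancel₀ (mul_ne_zero h₂ h₁),
    one_smul]

lemma R3bar_neg_mul_R3bar {u : ℂ} (h₁ : u + 3 * Complex.I / 2 ≠ 0)
    (h₂ : -u + 3 * Complex.I / 2 ≠ 0) : R3bar (-u) * R3bar u = 1 := by
  have : ((-u + 3 * Complex.I / 2) • (1 : LocalOp) - Complex.I • traceOp) *
      ((u + 3 * Complex.I / 2) • (1 : LocalOp) - Complex.I • traceOp) =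
      ((-u + 3 * Complex.I / 2) * (u + 3 * Complex.I / 2)) • (1 : LocalOp) := by
    simp only [sub_mul, mul_sub, smul_mul_assoc, mul_smul_comm, one_mul, mul_one,
      traceOp_mul_traceOp]
    module
  rw [R3bar, R3bar, smul_mul_smul_comm, this, smul_smul, ← mul_inv,
    inv_mul_cancel₀ (mul_ne_zero h₂ h₁), one_smul]

set_option maxHeartbeats 2000000 in
/-- On traceless operators the site map of the fundamental `R`-matrix is a combination of the
identity and of the commutator with the matrix unit `e_{s' s}`. -/
lemma siteMap_R3_apply (u : ℂ) (s s' a b : Fin 3) {X : Matrix (Fin 3) (Fin 3) ℂ}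
    (hX : X.trace = 0) :
    siteMap (R3 (-u)) (R3 u) s s' X a b =
      ((-u + Complex.I) * (u + Complex.I))⁻¹ * (-u ^ 2 * (if s = s' then X a b else 0) +
        -Complex.I * u * ((if a = s' then X s b else 0) - if s = b then X a s' else 0)) := by
  have hX' : X 2 2 = -X 0 0 - X 1 1 := by
    rw [Matrix.trace_fin_three] at hX
    linear_combination hX
  rw [mul_inv]
  generalize hk : (-u + Complex.I)⁻¹ = k
  generalize hl : (u + Complex.I)⁻¹ = l
  rw [siteMap_apply]
  fin_cases s <;> fin_cases s' <;> fin_cases a <;> fin_cases b <;>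
    simp [Matrix.mul_apply, auxBlock, R3, permOp, Fin.sum_univ_three, Matrix.one_apply, hk, hl,
      hX'] <;> ring

lemma R3bar_eq {u : ℂ} (h : u + 3 * Complex.I / 2 ≠ 0) :
    R3bar u = 1 - (Complex.I / (u + 3 * Complex.I / 2)) • traceOp := by
  rw [R3bar, smul_sub, inv_smul_smul₀ h, smul_smul, ← div_eq_inv_mul]

set_option maxHeartbeats 2000000 in
lemma siteMap_one_sub_smul_traceOp_apply (α β : ℂ) (s s' a b : Fin 3)
    (X : Matrix (Fin 3) (Fin 3) ℂ) :
    siteMap (1 - β • traceOp) (1 - α • traceOp) s s' X a b =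
      (if s = s' then X a b else 0) - α * (if a = s then X s' b else 0)
        - β * (if s' = b then X a s else 0) + α * β * (if a = b then X s' s else 0) := by
  rw [siteMap_apply]
  fin_cases s <;> fin_cases s' <;> fin_cases a <;> fin_cases b <;>
    simp [Matrix.mul_apply, auxBlock, traceOp, Fin.sum_univ_three, Matrix.one_apply] <;> ring

/-- The mean square of `p δ_{s s'} X + q [e_{s' s}, X]`. The sum over the commutators gives
`6 ‖X‖²`, the quadratic Casimir operator of the adjoint representation, and the mixed terms cancel
because `∑ s, [e_{s s}, X] = 0`. -/
lemma sum_normSq_add_commutator (p q : ℂ) {X : Matrix (Fin 3) (Fin 3) ℂ} (hX : X.trace = 0) :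
    ∑ s : Fin 3, ∑ s' : Fin 3, ∑ a, ∑ b, Complex.normSq (p * (if s = s' then X a b else 0) +
        q * ((if a = s' then X s b else 0) - if s = b then X a s' else 0)) =
      (3 * Complex.normSq p + 6 * Complex.normSq q) * hsSq X := by
  have hX' : X 2 2 = -X 0 0 - X 1 1 := by
    rw [Matrix.trace_fin_three] at hX
    linear_combination hX
  apply Complex.ofReal_injective
  simp [hsSq, Fin.sum_univ_three, ← Complex.mul_conj, hX']
  ring

set_option maxRecDepth 4000 in
/-- The mean square of the site maps of `siteMap_one_sub_smul_traceOp_apply`, with `γ` in place of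
`α * β`. -/
lemma sum_normSq_one_sub_smul_traceOp (α β γ : ℂ) {X : Matrix (Fin 3) (Fin 3) ℂ}
    (hX : X.trace = 0) :
    ∑ s : Fin 3, ∑ s' : Fin 3, ∑ a, ∑ b, Complex.normSq ((if s = s' then X a b else 0)
        - α * (if a = s then X s' b else 0) - β * (if s' = b then X a s else 0)
        + γ * (if a = b then X s' s else 0)) =
      (3 + 3 * Complex.normSq α + 3 * Complex.normSq β + 3 * Complex.normSq γ
        - 2 * (α + β).re - 2 * (star γ * (α + β)).re) * hsSq X := by
  have hX' : X 2 2 = -X 0 0 - X 1 1 := by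
    rw [Matrix.trace_fin_three] at hX
    linear_combination hX
  apply Complex.ofReal_injective
  simp only [Complex.ofReal_sub, Complex.ofReal_add, Complex.ofReal_mul, Complex.ofReal_ofNat,
    Complex.re_eq_add_conj]
  simp [hsSq, Fin.sum_univ_three, ← Complex.mul_conj, hX']
  ring

/-! ### Inversion in the physical strip -/

theorem t3Refl_mul_t3_asympEq_one {u : ℂ} (hu : u ∈ physicalStrip) :
    AsympEq (fun L => t3Refl L (-u) * t3 L u) (fun _ => 1) := by
  obtain ⟨hu₁, hu₂⟩ := abs_lt.1 (show |u.im| < 1 / 2 from hu)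
  have h₁ : u + Complex.I ≠ 0 := fun h => by
    have := congrArg Complex.im h
    simp at this
    linarith
  have h₂ : -u + Complex.I ≠ 0 := fun h => by
    have := congrArg Complex.im h
    simp at this
    linarith
  have hpos : 0 < Complex.normSq ((-u + Complex.I) * (u + Complex.I)) :=
    Complex.normSq_pos.2 (mul_ne_zero h₂ h₁)
  have hc : ∀ X : Matrix (Fin 3) (Fin 3) ℂ, X.trace = 0 →
      ∑ s, ∑ s', hsSq (siteMap (R3 (-u)) (R3 u) s s' X) =
        Complex.normSq ((-u + Complex.I) * (u + Complex.I))⁻¹ *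
          (3 * Complex.normSq (-u ^ 2) + 6 * Complex.normSq (-Complex.I * u)) * hsSq X := by
    intro X hX
    rw [mul_assoc, ← sum_normSq_add_commutator _ _ hX]
    simp only [hsSq, siteMap_R3_apply u _ _ _ _ hX, Complex.normSq_mul, ← Finset.mul_sum]
  refine asympEq_one_of_contraction (R3_neg_mul_R3 h₁ h₂) ?_ fun X hX => (hc X hX).le
  · rw [Complex.normSq_inv, inv_mul_lt_iff₀ hpos]
    -- The difference of the two sides is `3 * (1 - 4 * u.im ^ 2)`.
    simp only [Complex.normSq_apply, Complex.mul_re, Complex.mul_im, Complex.add_re,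
      Complex.add_im, Complex.neg_re, Complex.neg_im, Complex.I_re, Complex.I_im, pow_two]
    nlinarith

theorem t3barRefl_mul_t3bar_asympEq_one {u : ℂ} (hu : u ∈ physicalStrip) :
    AsympEq (fun L => t3barRefl L (-u) * t3bar L u) (fun _ => 1) := by
  obtain ⟨hu₁, hu₂⟩ := abs_lt.1 (show |u.im| < 1 / 2 from hu)
  have h₁ : u + 3 * Complex.I / 2 ≠ 0 := fun h => by
    have := congrArg Complex.im h
    simp at this
    linarith
  have h₂ : -u + 3 * Complex.I / 2 ≠ 0 := fun h => by
    have := congrArg Complex.im h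
    simp at this
    linarith
  refine asympEq_one_of_contraction (R3bar_neg_mul_R3bar h₁ h₂) ?_ fun X hX =>
    (show _ = _ by
      simp only [R3bar_eq h₁, R3bar_eq h₂, hsSq, siteMap_one_sub_smul_traceOp_apply]
      exact sum_normSq_one_sub_smul_traceOp _ _ _ hX).le
  · set v := u + 3 * Complex.I / 2 with hv
    set w := -u + 3 * Complex.I / 2 with hw
    have hV := Complex.normSq_pos.2 h₁
    have hW := Complex.normSq_pos.2 h₂
    -- As `v + w = 3 i`, the mixed terms of the mean square reduce to `α * β`.
    have hsum : Complex.I / v + Complex.I / w = 3 * (Complex.I / v * (Complex.I / w)) := by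
      have : v + w = 3 * Complex.I := by rw [hv, hw]; ring
      field_simp
      linear_combination this
    have hre : (Complex.I / v * (Complex.I / w)).re =
        -(v * w).re / (Complex.normSq v * Complex.normSq w) := by
      rw [div_mul_div_comm, Complex.I_mul_I, Complex.div_re, Complex.normSq_mul]
      simp
    -- The left side is `‖v + conj w‖²`, and `v + conj w = 2 i Im u`.
    have key : Complex.normSq v + Complex.normSq w + 2 * (v * w).re < 1 := by
      have e : Complex.normSq v + Complex.normSq w + 2 * (v * w).re = 4 * u.im ^ 2 := by
        simp [hv, hw, Complex.normSq_apply]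
        ring
      nlinarith
    rw [hsum]
    generalize hγ : Complex.I / v * (Complex.I / w) = γ at hre ⊢
    have hγ' : Complex.normSq γ = 1 / (Complex.normSq v * Complex.normSq w) := by
      rw [← hγ]; simp [Complex.normSq_mul, mul_comm]
    have h3 : (3 * γ).re = 3 * γ.re := by simp
    have h4 : (star γ * (3 * γ)).re = 3 * Complex.normSq γ := by
      simp [Complex.normSq_apply]; ring
    rw [h3, h4, hγ', hre, Complex.normSq_div, Complex.normSq_div, Complex.normSq_I]
    have e : 3 + 3 * (1 / Complex.normSq v) + 3 * (1 / Complex.normSq w) +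
        3 * (1 / (Complex.normSq v * Complex.normSq w)) -
        2 * (3 * (-(v * w).re / (Complex.normSq v * Complex.normSq w))) -
        2 * (3 * (1 / (Complex.normSq v * Complex.normSq w))) = 3 -
        3 * (1 - (Complex.normSq v + Complex.normSq w + 2 * (v * w).re)) /
          (Complex.normSq v * Complex.normSq w) := by
      field_simp
      ring
    rw [e]
    have : 0 < 3 * (1 - (Complex.normSq v + Complex.normSq w + 2 * (v * w).re)) /
        (Complex.normSq v * Complex.normSq w) := by
      have := sub_pos.2 key
      positivity
    linarith

end LaiSutherland

theorem mainTheorem1 (u : ℂ) (hu : u ∈ LaiSutherland.physicalStrip) :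
    LaiSutherland.AsympEq
        (fun L => LaiSutherland.t3Refl L (-u) * LaiSutherland.t3 L u) (fun _ => 1) ∧
      LaiSutherland.AsympEq
        (fun L => LaiSutherland.t3barRefl L (-u) * LaiSutherland.t3bar L u) (fun _ => 1) :=
  ⟨LaiSutherland.t3Refl_mul_t3_asympEq_one hu, LaiSutherland.t3barRefl_mul_t3bar_asympEq_one hu⟩
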